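/- **Setting.** Let $\mathcal G=(\mathcal V,\mathcal E)$ be a finite directed graph, $(v_j,v_i)\in\mathcal E$ meaning that $v_i$ receives from $v_j$; let $\mathcal N_i^{\rm in}$ be the set of in-neighbours of $v_i$ and $\bar{\mathcal N}_i=\mathcal N_i^{\rm in}\cup\{v_i\}$. Let $\mathcal A\subset\mathcal V$ be the set of Byzantine nodes, $\mathcal R=\mathcal V\setminus\mathcal A$ the set of regular nodes, $F\ge 1$ an integer, and let every node $v_i$ have a convex function $f_i:\mathbb R^d\to\mathbb R$ with subdifferential $\partial f_i$. A set $\mathcal S\subseteq\mathcal V$ is *$r$-reachable* if some $v_i\in\mathcal S$ satisfies $|\mathcal N_i^{\rm in}\setminus\mathcal S|\ge r$; $\mathcal G$ is *$r$-robust* if for all disjoint nonempty $\mathcal S_1,\mathcal S_2\subset\mathcal V$ at least one of them is $r$-reachable. **Algorithm 1.** Every regular node $v_i$ starts from $x_i[0]=y_i[0]=\hat x_i$, where $\hat x_i\in\mathbb R^d$ is any point (for instance an approximate minimizer of $f_i$). At each time $k=0,1,2,\dots$ it receives from each $v_j\in\bar{\mathcal N}_i$ vectors $x_{j\to i}[k],y_{j\to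 i}[k]\in\mathbb R^d$; these equal $x_j[k],y_j[k]$ if $v_j\in\mathcal R$, and are arbitrary (they may depend on $i$) if $v_j\in\mathcal A$. "Removing the $F$ largest values larger than its own" means discarding $F$ nodes whose values are the largest, counted with multiplicity, among those strictly larger than the value of $v_i$, or all of the latter if there are fewer than $F$ of them; "smallest" is analogous, and ties are broken arbitrarily. 1. (Distance filter) Among the nodes $v_j\in\bar{\mathcal N}_i$ with values $\|x_{j\to i}[k]-y_i[k]\|$, $v_i$ removes the $F$ largest values larger than its own; $\mathcal V_i^{\rm dist}[k]$ is the set of remaining nodes. 2. (Min-max filter) For each $\ell\in\{1,\dots,d\}$, $\mathcal V_i^{\rm remove}(\ell)[k]$ consists of the nodes discarded when $v_i$ removes, among the values $x_{j\to i}^{(\ell)}[k]$, $v_j\in\mathcal V_i^{\rm dist}[k]$, the $F$ largest ones larger than its own and the $F$ smallest ones smaller than its own. Set $\mathcal V_i^{\rm mm}[k]=\mathcal V_i^{\rm dist}[k]\setminus\bigcup_\ell\mathcal V_i^{\rm remove}(\ell)[k]$. 3. $z_i[k]=\sum_{v_j\in\mathcal V_i^{\rm mm}[k]}w_{x,ij}[k]\,x_{j\to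 i}[k]$, with positive weights summing to $1$ over $\mathcal V_i^{\rm mm}[k]$. 4. $x_i[k+1]=z_i[k]-\eta[k]\,g_i[k]$ for some $g_i[k]\in\partial f_i(z_i[k])$. 5. For each $\ell$, $v_i$ removes, among the values $y_{j\to i}^{(\ell)}[k]$, $v_j\in\bar{\mathcal N}_i$, the $F$ largest ones larger than its own and the $F$ smallest ones smaller than its own; $\mathcal V_i^{y}[k](\ell)$ is the set of remaining nodes, and $y_i^{(\ell)}[k+1]=\sum_{v_j\in\mathcal V_i^{y}[k](\ell)}w_{y,ij}^{(\ell)}[k]\,y_{j\to i}^{(\ell)}[k]$, with positive weights summing to $1$ over $\mathcal V_i^{y}[k](\ell)$. Byzantine nodes may behave arbitrarily. **Theorem (Consensus).** Suppose that - there is $L>0$ with $\|g\|\le L$ for all $v_i\in\mathcal V$, $x\in\mathbb R^d$ and $g\in\partial f_i(x)$; - $\eta[k]=\dfrac{c_1}{k+c_2}$ for all $k\in\mathbb N$, for some $c_1,c_2>0$; - $\mathcal A$ is $F$-local: $|\mathcal N_i^{\rm in}\cap\mathcal A|\le F$ for all $v_i\in\mathcal R$; - for all $v_i\in\mathcal R$,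 $k$ and $\ell$, $w_{x,ij}[k]>0$ if and only if $v_j\in\mathcal V_i^{\rm mm}[k]$, and $w_{y,ij}^{(\ell)}[k]>0$ if and only if $v_j\in\mathcal V_i^{y}[k](\ell)$; and there is $\omega>0$ such that all the nonzero weights of regular nodes are at least $\omega$, for all $k$ and $\ell$; - $\mathcal G$ is $((2d+1)F+1)$-robust. If the regular nodes follow Algorithm 1, then for all $v_i,v_j\in\mathcal R$, $$\lim_{k\to\infty}\|x_i[k]-x_j[k]\|=0 .$$ -/

import Mathlib

open Filter Topology

namespace ResilientOpt

section Graph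

variable {V : Type*} [Fintype V] [DecidableEq V]

open Classical in
/-- In-neighbours of `i`: the nodes `j` with an edge `j → i`, i.e. from which `i` receives. -/
noncomputable def inNbrs (G : Digraph V) (i : V) : Finset V :=
  Finset.univ.filter (fun j => G.Adj j i)

/-- `S` is `r`-reachable: some node of `S` has at least `r` in-neighbours outside `S`. -/
def IsReachableSet (G : Digraph V) (r : ℕ) (S : Finset V) : Prop :=
  ∃ i ∈ S, r ≤ (inNbrs G i \ S).card

/-- `G` is `r`-robust. -/
def IsRobust (G : Digraph V) (r : ℕ) : Prop :=
  ∀ S₁ S₂ : Finset V, S₁.Nonempty → S₂.Nonempty → Disjoint S₁ S₂ →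
    IsReachableSet G r S₁ ∨ IsReachableSet G r S₂

/-- The set `A` of Byzantine nodes is `F`-local: every regular node (every node outside `A`)
has at most `F` Byzantine in-neighbours. -/
def IsLocalSet (G : Digraph V) (F : ℕ) (A : Finset V) : Prop :=
  ∀ i, i ∉ A → (inNbrs G i ∩ A).card ≤ F

end Graph

/-- The subdifferential of `f` at `x`. -/
def subdifferential {d : ℕ} (f : EuclideanSpace ℝ (Fin d) → ℝ) (x : EuclideanSpace ℝ (Fin d)) :
    Set (EuclideanSpace ℝ (Fin d)) :=
  {g | ∀ y, f x + inner ℝ g (y - x) ≤ f y}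

/-- `T` is a possible set of nodes discarded by node `i` when, among the nodes of `s` carrying the
values `val`, it removes the `F` largest values that are strictly larger than its own value
(all of these if there are fewer than `F`). Values are counted with multiplicity; every way of
breaking ties gives an admissible `T`. Equivalently, `T` is the set of those nodes among the `F`
largest of `s` whose value is strictly larger than that of `i`. -/
structure RemovesLargest {V : Type*} (F : ℕ) (s : Finset V) (val : V → ℝ) (i : V)
    (T : Finset V) : Prop where
  subset : T ⊆ s.filter (fun j => val i < val j)
  card : T.card = min F (s.filter (fun j => val i < val j)).card
  largest : ∀ j ∈ s.filter (fun j => val i < val j), j ∉ T → ∀ t ∈ T, val j ≤ val t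

/-- The same with the `F` smallest values that are strictly smaller than the value of `i`. -/
def RemovesSmallest {V : Type*} (F : ℕ) (s : Finset V) (val : V → ℝ) (i : V)
    (T : Finset V) : Prop :=
  RemovesLargest F s (fun j => - val j) i T

/-- All the quantities occurring in an execution with nodes `V` in dimension `d`; the first
argument `k : ℕ` is the time-step and the second one the node. No law is imposed here. -/
structure Run (V : Type*) (d : ℕ) where
  /-- the points that initialize the nodes, e.g. approximate minimizers of the local functions at
  an arbitrary finite distance from true minimizers; nothing is required of them -/
  xhat : V → EuclideanSpace ℝ (Fin d)
  /-- the states `x_i[k]` -/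
  x : ℕ → V → EuclideanSpace ℝ (Fin d)
  /-- the estimated auxiliary points `y_i[k]` -/
  y : ℕ → V → EuclideanSpace ℝ (Fin d)
  /-- the intermediate states `z_i[k]` -/
  z : ℕ → V → EuclideanSpace ℝ (Fin d)
  /-- the subgradients `g_i[k]` -/
  g : ℕ → V → EuclideanSpace ℝ (Fin d)
  /-- `byzX k a i`: the vector which the Byzantine node `a` sends to `i` in place of a state -/
  byzX : ℕ → V → V → EuclideanSpace ℝ (Fin d)
  /-- `byzY k a i`: the vector which the Byzantine node `a` sends to `i` in place of an
  auxiliary point -/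
  byzY : ℕ → V → V → EuclideanSpace ℝ (Fin d)
  /-- nodes discarded by the distance filter -/
  distRem : ℕ → V → Finset V
  /-- nodes discarded by the min-max filter for a large `ℓ`-th component of the state -/
  xHighRem : ℕ → V → Fin d → Finset V
  /-- nodes discarded by the min-max filter for a small `ℓ`-th component of the state -/
  xLowRem : ℕ → V → Fin d → Finset V
  /-- nodes whose `ℓ`-th auxiliary component is discarded for being large -/
  yHighRem : ℕ → V → Fin d → Finset V
  /-- nodes whose `ℓ`-th auxiliary component is discarded for being small -/
  yLowRem : ℕ → V → Fin d → Finset V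
  /-- `wx k i j`: the weight `w_{x,ij}[k]` -/
  wx : ℕ → V → V → ℝ
  /-- `wy k i ℓ j`: the weight `w^{(ℓ)}_{y,ij}[k]` -/
  wy : ℕ → V → Fin d → V → ℝ

namespace Run

variable {V : Type*} [Fintype V] [DecidableEq V] {d : ℕ}

/-- The state that node `i` receives from node `j` at time `k` (`A` = the Byzantine nodes). -/
def recvX (ρ : Run V d) (A : Finset V) (k : ℕ) (i j : V) : EuclideanSpace ℝ (Fin d) :=
  if j ∈ A then ρ.byzX k j i else ρ.x k j

/-- The auxiliary point that node `i` receives from node `j` at time `k`. -/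
def recvY (ρ : Run V d) (A : Finset V) (k : ℕ) (i j : V) : EuclideanSpace ℝ (Fin d) :=
  if j ∈ A then ρ.byzY k j i else ρ.y k j

/-- Nodes whose states survive the distance filter at node `i`. -/
noncomputable def distKept (ρ : Run V d) (G : Digraph V) (k : ℕ) (i : V) : Finset V :=
  insert i (inNbrs G i) \ ρ.distRem k i

/-- Nodes whose states survive both the distance filter and the min-max filter at node `i`: the
whole state is dropped as soon as one of its components is discarded. -/
noncomputable def mmKept (ρ : Run V d) (G : Digraph V) (k : ℕ) (i : V) : Finset V :=
  ρ.distKept G k i \ Finset.univ.biUnion (fun ℓ => ρ.xHighRem k i ℓ ∪ ρ.xLowRem k i ℓ)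

/-- Nodes whose `ℓ`-th auxiliary component survives the min-max filter at node `i`. -/
noncomputable def yKept (ρ : Run V d) (G : Digraph V) (k : ℕ) (i : V) (ℓ : Fin d) : Finset V :=
  insert i (inNbrs G i) \ (ρ.yHighRem k i ℓ ∪ ρ.yLowRem k i ℓ)

/-- In the run `ρ` all regular nodes (those outside `A`) follow the simultaneous distance and
min-max filtering dynamics over `G`, with filter parameter `F`, local functions `f` and
step-sizes `η`. Nothing is required of the nodes in `A`. -/
structure Follows (ρ : Run V d) (G : Digraph V) (A : Finset V) (F : ℕ)
    (f : V → EuclideanSpace ℝ (Fin d) → ℝ) (η : ℕ → ℝ) : Prop where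
  x_init : ∀ i, i ∉ A → ρ.x 0 i = ρ.xhat i
  y_init : ∀ i, i ∉ A → ρ.y 0 i = ρ.xhat i
  dist_filt : ∀ k i, i ∉ A →
    RemovesLargest F (insert i (inNbrs G i)) (fun j => ‖ρ.recvX A k i j - ρ.y k i‖) i
      (ρ.distRem k i)
  x_high_filt : ∀ k i, i ∉ A → ∀ ℓ,
    RemovesLargest F (ρ.distKept G k i) (fun j => ρ.recvX A k i j ℓ) i (ρ.xHighRem k i ℓ)
  x_low_filt : ∀ k i, i ∉ A → ∀ ℓ,
    RemovesSmallest F (ρ.distKept G k i) (fun j => ρ.recvX A k i j ℓ) i (ρ.xLowRem k i ℓ)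
  wx_pos : ∀ k i, i ∉ A → ∀ j ∈ ρ.mmKept G k i, 0 < ρ.wx k i j
  wx_sum : ∀ k i, i ∉ A → ∑ j ∈ ρ.mmKept G k i, ρ.wx k i j = 1
  z_eq : ∀ k i, i ∉ A → ρ.z k i = ∑ j ∈ ρ.mmKept G k i, ρ.wx k i j • ρ.recvX A k i j
  g_mem : ∀ k i, i ∉ A → ρ.g k i ∈ subdifferential (f i) (ρ.z k i)
  x_succ : ∀ k i, i ∉ A → ρ.x (k + 1) i = ρ.z k i - η k • ρ.g k i
  y_high_filt : ∀ k i, i ∉ A → ∀ ℓ,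
    RemovesLargest F (insert i (inNbrs G i)) (fun j => ρ.recvY A k i j ℓ) i (ρ.yHighRem k i ℓ)
  y_low_filt : ∀ k i, i ∉ A → ∀ ℓ,
    RemovesSmallest F (insert i (inNbrs G i)) (fun j => ρ.recvY A k i j ℓ) i (ρ.yLowRem k i ℓ)
  wy_pos : ∀ k i, i ∉ A → ∀ ℓ, ∀ j ∈ ρ.yKept G k i ℓ, 0 < ρ.wy k i ℓ j
  wy_sum : ∀ k i, i ∉ A → ∀ ℓ, ∑ j ∈ ρ.yKept G k i ℓ, ρ.wy k i ℓ j = 1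
  y_succ : ∀ k i, i ∉ A → ∀ ℓ,
    ρ.y (k + 1) i ℓ = ∑ j ∈ ρ.yKept G k i ℓ, ρ.wy k i ℓ j * ρ.recvY A k i j ℓ

/-- The weight assumption: the weights of the regular nodes are positive exactly on the retained
values, and the nonzero ones are bounded below by a common `ω > 0`. -/
def WeightAssumption (ρ : Run V d) (G : Digraph V) (A : Finset V) : Prop :=
  (∀ k i, i ∉ A → ∀ j, 0 < ρ.wx k i j ↔ j ∈ ρ.mmKept G k i) ∧
  (∀ k i, i ∉ A → ∀ ℓ j, 0 < ρ.wy k i ℓ j ↔ j ∈ ρ.yKept G k i ℓ) ∧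
  ∃ ω : ℝ, 0 < ω ∧
    (∀ k i, i ∉ A → ∀ j, ρ.wx k i j ≠ 0 → ω ≤ ρ.wx k i j) ∧
    (∀ k i, i ∉ A → ∀ ℓ j, ρ.wy k i ℓ j ≠ 0 → ω ≤ ρ.wy k i ℓ j)

end Run

end ResilientOpt

/-! The argument runs coordinate by coordinate. Let all regular values of one coordinate lie in [m,
M], and let b ≤ M. By F-locality, every value kept by a regular node is at most M. If the node
itself is above b but has (2d+1)F+1 in-neighbours that are not regular nodes above b, at most F of
these are Byzantine, so more than 2dF are regular with value at most b. Its filter against large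
values of this coordinate touches none of them; the distance filter and the other 2d-1 coordinate
filters discard at most 2dF nodes. So some value at most b survives, with weight at least ω, and the
average is at most M - ω(M - b). Only the size of the distance filter's discarded set, and that it
spares the node itself, matter. `ContractsAbove` records this, with the subgradient step as a
perturbation u = ηL; the same holds for the negated coordinate.

Consider next the regular nodes above a threshold starting at the midpoint of [m, M] and those below
the mirrored one. The thresholds move so that both sets only shrink and stay disjoint. While both
are nonempty, robustness makes one of them lose a node at each step, so after |V| steps one is
empty. Hence the spread contracts by 1 - ω^|V|/2 over |V| steps, up to 2|V|u (`sub_le_of_isRobust`).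
As u tends to 0, so does the spread. -/

namespace ResilientOpt

/-! ### Weighted averages and counting for the filters -/

section Weighted

variable {V : Type*}

/-- A weighted average of values at most `M`, one of which is at most `b` and has weight at
least `ω`, is at most `M - ω (M - b)`. -/
theorem sum_mul_le_of_weight_le {K : Finset V} {w val : V → ℝ} {M b ω : ℝ} {j : V}
    (hw : ∀ i ∈ K, 0 ≤ w i) (hsum : ∑ i ∈ K, w i = 1) (hM : ∀ i ∈ K, val i ≤ M)
    (hj : j ∈ K) (hjb : val j ≤ b) (hjω : ω ≤ w j) (hbM : b ≤ M) :
    ∑ i ∈ K, w i * val i ≤ M - ω * (M - b) := by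
  have h1 : w j * (M - val j) ≤ ∑ i ∈ K, w i * (M - val i) :=
    Finset.single_le_sum (f := fun i => w i * (M - val i))
      (fun i hi => mul_nonneg (hw i hi) (sub_nonneg.2 (hM i hi))) hj
  have h2 : ∑ i ∈ K, w i * (M - val i) = M - ∑ i ∈ K, w i * val i := by
    simp only [mul_sub, Finset.sum_sub_distrib, ← Finset.sum_mul, hsum, one_mul]
  have h3 : ω * (M - b) ≤ w j * (M - val j) :=
    mul_le_mul hjω (by linarith) (by linarith) (hw j hj)
  linarith

theorem RemovesLargest.card_le {F : ℕ} {s : Finset V} {val : V → ℝ} {i : V} {T : Finset V}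
    (h : RemovesLargest F s val i T) : T.card ≤ F :=
  h.card ▸ min_le_left _ _

theorem RemovesLargest.lt_of_mem {F : ℕ} {s : Finset V} {val : V → ℝ} {i j : V} {T : Finset V}
    (h : RemovesLargest F s val i T) (hj : j ∈ T) : val i < val j :=
  (Finset.mem_filter.1 (h.subset hj)).2

variable [DecidableEq V]

/-- If all but at most `F` nodes have values at most `M`, so do all nodes that are kept. -/
theorem RemovesLargest.le_of_notMem {F : ℕ} {s A : Finset V} {val : V → ℝ} {i j : V}
    {T : Finset V} {M : ℝ} (h : RemovesLargest F s val i T) (hA : (s ∩ A).card ≤ F)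
    (hM : ∀ j ∈ s, j ∉ A → val j ≤ M) (hi : val i ≤ M) (hj : j ∈ s) (hjT : j ∉ T) :
    val j ≤ M := by
  by_contra! hlt
  have hjf : j ∈ s.filter (fun j => val i < val j) :=
    Finset.mem_filter.2 ⟨hj, hi.trans_lt hlt⟩
  have hlt_card : T.card < (s.filter (fun j => val i < val j)).card :=
    Finset.card_lt_card ⟨h.subset, fun hs => hjT (hs hjf)⟩
  -- An eligible node was kept, so the filter used its full quota `F`; together with `j` this makes
  -- `F + 1` nodes above `M`, all in `A`.
  have hcard : T.card = F := by have := h.card; omega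
  have hsub : insert j T ⊆ s ∩ A := by
    intro t ht
    have hts : t ∈ s ∧ M < val t := by
      rcases Finset.mem_insert.1 ht with rfl | ht
      · exact ⟨hj, hlt⟩
      · exact ⟨(Finset.mem_filter.1 (h.subset ht)).1, hlt.trans_le (h.largest j hjf hjT t ht)⟩
    refine Finset.mem_inter.2 ⟨hts.1, ?_⟩
    by_contra htA
    exact absurd (hM t hts.1 htA) (not_le.2 hts.2)
  have := Finset.card_le_card hsub
  rw [Finset.card_insert_of_notMem hjT] at this
  omega

/-- A set of more than `2dF` nodes that avoids `P ℓ` is not exhausted by the `2d + 1` discarded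
sets. -/
theorem exists_mem_notMem_discarded {d F : ℕ} {N D : Finset V} {P Q : Fin d → Finset V}
    (ℓ : Fin d) (hN : 2 * d * F < N.card) (hD : D.card ≤ F) (hP : ∀ m, (P m).card ≤ F)
    (hQ : ∀ m, (Q m).card ≤ F) (hdisj : ∀ j ∈ N, j ∉ P ℓ) :
    ∃ j ∈ N, j ∉ D ∧ ∀ m, j ∉ P m ∧ j ∉ Q m := by
  by_contra! hcon
  -- Leaving out `P ℓ`, there remain 1 + (d - 1) + d = 2d sets of at most `F` nodes.
  have hsub : N ⊆ D ∪ ((Finset.univ.erase ℓ).biUnion P ∪ Finset.univ.biUnion Q) := by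
    intro j hj
    by_cases hjD : j ∈ D
    · exact Finset.mem_union_left _ hjD
    obtain ⟨m, hm⟩ := hcon j hj hjD
    refine Finset.mem_union_right _ ?_
    by_cases hjP : j ∈ P m
    · refine Finset.mem_union_left _ (Finset.mem_biUnion.2 ⟨m, ?_, hjP⟩)
      refine Finset.mem_erase.2 ⟨?_, Finset.mem_univ _⟩
      rintro rfl
      exact hdisj j hj hjP
    · exact Finset.mem_union_right _ (Finset.mem_biUnion.2 ⟨m, Finset.mem_univ _, hm hjP⟩)
  have h1 := (Finset.card_le_card hsub).trans (Finset.card_union_le _ _)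
  have h2 := Finset.card_union_le ((Finset.univ.erase ℓ).biUnion P) (Finset.univ.biUnion Q)
  have h3 := Finset.card_biUnion_le_card_mul (Finset.univ.erase ℓ) P F (fun m _ => hP m)
  have h4 := Finset.card_biUnion_le_card_mul Finset.univ Q F (fun m _ => hQ m)
  rw [Finset.card_erase_of_mem (Finset.mem_univ _), Finset.card_univ, Fintype.card_fin] at h3
  rw [Finset.card_univ, Fintype.card_fin] at h4
  obtain ⟨e, rfl⟩ : ∃ e, d = e + 1 := ⟨d - 1, by have := ℓ.pos; omega⟩
  rw [Nat.add_sub_cancel] at h3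
  nlinarith

end Weighted

/-! ### Perturbed contractions of real sequences -/

section Scalar

/-- A nonnegative sequence that contracts up to a vanishing perturbation vanishes. -/
theorem tendsto_zero_of_le_mul_add {a c : ℕ → ℝ} {q : ℝ} (hq0 : 0 ≤ q) (hq1 : q < 1)
    (ha : ∀ n, 0 ≤ a n) (hc : Tendsto c atTop (𝓝 0)) (h : ∀ n, a (n + 1) ≤ q * a n + c n) :
    Tendsto a atTop (𝓝 0) := by
  rw [Metric.tendsto_atTop]
  intro ε hε
  have hδ : 0 < (1 - q) * (ε / 2) := mul_pos (by linarith) (by linarith)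
  obtain ⟨n₀, hn₀⟩ := Filter.eventually_atTop.1 (hc.eventually_lt_const hδ)
  have hbound : ∀ n, a (n₀ + n) ≤ q ^ n * a n₀ + ε / 2 := by
    intro n
    induction n with
    | zero => simp; linarith
    | succ n ih =>
      have h1 := h (n₀ + n)
      have h2 := hn₀ (n₀ + n) (by omega)
      have h3 := mul_le_mul_of_nonneg_left ih hq0
      calc a (n₀ + (n + 1)) ≤ q * a (n₀ + n) + c (n₀ + n) := h1
        _ ≤ q * (q ^ n * a n₀ + ε / 2) + (1 - q) * (ε / 2) := by linarith
        _ = q ^ (n + 1) * a n₀ + ε / 2 := by ring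
  have hpow : Tendsto (fun n : ℕ => q ^ n * a n₀) atTop (𝓝 0) := by
    simpa using (tendsto_pow_atTop_nhds_zero_of_lt_one hq0 hq1).mul_const (a n₀)
  obtain ⟨n₁, hn₁⟩ := Filter.eventually_atTop.1 (hpow.eventually_lt_const (half_pos hε))
  refine ⟨n₀ + n₁, fun n hn => ?_⟩
  rw [Real.dist_eq, sub_zero, abs_of_nonneg (ha n)]
  have h1 := hbound (n - n₀)
  have h2 := hn₁ (n - n₀) (by omega)
  rw [show n₀ + (n - n₀) = n by omega] at h1
  linarith

/-- The same for a contraction over `N` steps. -/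
theorem tendsto_zero_of_add_le_mul_add {a c : ℕ → ℝ} {q : ℝ} {N : ℕ} (hN : 0 < N) (hq0 : 0 ≤ q)
    (hq1 : q < 1) (ha : ∀ n, 0 ≤ a n) (hc : Tendsto c atTop (𝓝 0))
    (h : ∀ n, a (n + N) ≤ q * a n + c n) : Tendsto a atTop (𝓝 0) := by
  have hres : ∀ r, Tendsto (fun n => a (N * n + r)) atTop (𝓝 0) := by
    intro r
    have hNr : Tendsto (fun n => N * n + r) atTop atTop :=
      tendsto_atTop_mono (fun n => (Nat.le_mul_of_pos_left n hN).trans (Nat.le_add_right _ r))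
        tendsto_id
    refine tendsto_zero_of_le_mul_add hq0 hq1 (fun n => ha _) (hc.comp hNr) (fun n => ?_)
    have := h (N * n + r)
    rwa [show N * n + r + N = N * (n + 1) + r by ring] at this
  -- Summing over all residues avoids treating k mod N separately: `a k` is one of these nonnegative
  -- terms.
  have hsum : Tendsto (fun k => ∑ r ∈ Finset.range N, a (N * (k / N) + r)) atTop (𝓝 0) := by
    have := tendsto_finsetSum (Finset.range N)
      (fun r _ => (hres r).comp (Nat.tendsto_div_const_atTop hN.ne'))
    simpa using this
  refine squeeze_zero ha (fun k => ?_) hsum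
  have := Finset.single_le_sum (f := fun r => a (N * (k / N) + r)) (fun r _ => ha _)
    (Finset.mem_range.2 (Nat.mod_lt k hN))
  simpa only [Nat.div_add_mod] using this

end Scalar

/-! ### Scalar consensus over a robust graph -/

section Consensus

variable {V : Type*} [Fintype V] [DecidableEq V]

/-- The regular nodes whose value exceeds `b`. -/
noncomputable def highSet (A : Finset V) (v : V → ℝ) (b : ℝ) : Finset V :=
  Finset.univ.filter (fun j => j ∉ A ∧ b < v j)

/-- A regular node whose value is at most `b`, or which has `r` in-neighbours that are not regular
nodes with value above `b`, moves away from the upper bound `M` by at least `ω (M - b)`, up to the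
perturbation `u`. -/
def ContractsAbove (G : Digraph V) (A : Finset V) (r : ℕ) (ω : ℝ) (u : ℕ → ℝ)
    (x : ℕ → V → ℝ) : Prop :=
  ∀ k i, i ∉ A → ∀ M b : ℝ, (∀ j, j ∉ A → x k j ≤ M) → b ≤ M →
    (x k i ≤ b ∨ r ≤ (inNbrs G i \ highSet A (x k) b).card) →
    x (k + 1) i ≤ M - ω * (M - b) + u k

variable {G : Digraph V} {A : Finset V} {r : ℕ} {ω : ℝ} {u : ℕ → ℝ} {x : ℕ → V → ℝ}

theorem mem_highSet {v : V → ℝ} {b : ℝ} {j : V} : j ∈ highSet A v b ↔ j ∉ A ∧ b < v j := by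
  simp [highSet]

namespace ContractsAbove

theorem le_add (h : ContractsAbove G A r ω u x) (hu : Antitone u) {k : ℕ} {M : ℝ}
    (hM : ∀ j, j ∉ A → x k j ≤ M) (t : ℕ) :
    ∀ j, j ∉ A → x (k + t) j ≤ M + t * u k := by
  induction t with
  | zero => simpa using hM
  | succ t ih =>
    intro j hj
    -- With b equal to the upper bound the contraction term vanishes, and only the perturbation is
    -- added.
    have h1 := h (k + t) j hj _ _ ih le_rfl (Or.inl (ih j hj))
    have h2 := hu (Nat.le_add_right k t)
    rw [← add_assoc]
    push_cast
    linarith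

/-- The set of nodes above the threshold `M + t u - ω ^ t δ`, `t` steps after time `k`. -/
noncomputable def level (A : Finset V) (ω : ℝ) (u : ℕ → ℝ) (x : ℕ → V → ℝ) (k : ℕ) (M δ : ℝ)
    (t : ℕ) : Finset V :=
  highSet A (x (k + t)) (M + t * u k - ω ^ t * δ)

/-- The thresholds are designed for this: with upper bound M + t u and gap ω ^ t δ, one contraction
leaves the gap ω ^ (t + 1) δ below M + (t + 1) u. -/
theorem notMem_level_succ (h : ContractsAbove G A r ω u x) (hu : Antitone u) (hω : 0 ≤ ω)
    {k : ℕ} {M δ : ℝ} (hδ : 0 ≤ δ) (hM : ∀ j, j ∉ A → x k j ≤ M) {t : ℕ} {i : V}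
    (hi : i ∉ level A ω u x k M δ t ∨ r ≤ (inNbrs G i \ level A ω u x k M δ t).card) :
    i ∉ level A ω u x k M δ (t + 1) := by
  intro hmem
  obtain ⟨hiA, hlt⟩ := mem_highSet.1 hmem
  have hωδ : 0 ≤ ω ^ t * δ := by positivity
  have h1 := h (k + t) i hiA _ (M + t * u k - ω ^ t * δ) (h.le_add hu hM t) (by linarith) <| by
    refine hi.imp_left fun hi => ?_
    by_contra! hcon
    exact hi (mem_highSet.2 ⟨hiA, hcon⟩)
  have h2 := hu (Nat.le_add_right k t)
  rw [← add_assoc] at hlt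
  push_cast at hlt
  rw [pow_succ] at hlt
  linarith

theorem level_succ_subset (h : ContractsAbove G A r ω u x) (hu : Antitone u) (hω : 0 ≤ ω)
    {k : ℕ} {M δ : ℝ} (hδ : 0 ≤ δ) (hM : ∀ j, j ∉ A → x k j ≤ M) (t : ℕ) :
    level A ω u x k M δ (t + 1) ⊆ level A ω u x k M δ t := by
  intro i hi
  by_contra hcon
  exact h.notMem_level_succ hu hω hδ hM (Or.inl hcon) hi

theorem card_level_succ_lt (h : ContractsAbove G A r ω u x) (hu : Antitone u) (hω : 0 ≤ ω)
    {k : ℕ} {M δ : ℝ} (hδ : 0 ≤ δ) (hM : ∀ j, j ∉ A → x k j ≤ M) {t : ℕ}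
    (hr : IsReachableSet G r (level A ω u x k M δ t)) :
    (level A ω u x k M δ (t + 1)).card < (level A ω u x k M δ t).card := by
  obtain ⟨i, hi, hir⟩ := hr
  exact Finset.card_lt_card ⟨h.level_succ_subset hu hω hδ hM t,
    fun hs => h.notMem_level_succ hu hω hδ hM (Or.inr hir) (hs hi)⟩

theorem le_of_level_eq_empty {k t : ℕ} {M δ : ℝ} (h : level A ω u x k M δ t = ∅) {j : V}
    (hj : j ∉ A) : x (k + t) j ≤ M + t * u k - ω ^ t * δ := by
  by_contra! hcon
  have hmem : j ∈ level A ω u x k M δ t := mem_highSet.2 ⟨hj, hcon⟩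
  simp [h] at hmem

/-- Over a robust graph, the spread of the regular values contracts over `|V|` steps. -/
theorem sub_le_of_isRobust (hx : ContractsAbove G A r ω u x) (hx' : ContractsAbove G A r ω u (-x))
    (hG : IsRobust G r) (hu : Antitone u) (hu0 : ∀ k, 0 ≤ u k) (hω : 0 ≤ ω) (hω1 : ω ≤ 1)
    {k : ℕ} {M m : ℝ} (hmM : m ≤ M) (hM : ∀ j, j ∉ A → x k j ≤ M) (hm : ∀ j, j ∉ A → m ≤ x k j)
    {i j : V} (hi : i ∉ A) (hj : j ∉ A) :
    x (k + Fintype.card V) i - x (k + Fintype.card V) j ≤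
      (1 - ω ^ Fintype.card V / 2) * (M - m) + 2 * Fintype.card V * u k := by
  -- With δ half the spread, both thresholds start at the midpoint; later they only move apart,
  -- since ω ≤ 1 and u ≥ 0, which keeps the level sets disjoint.
  have hδ : 0 ≤ (M - m) / 2 := by linarith
  have hm' : ∀ j, j ∉ A → (-x) k j ≤ -m := fun j hj => neg_le_neg (hm j hj)
  set S := level A ω u x k M ((M - m) / 2) with hS
  set S' := level A ω u (-x) k (-m) ((M - m) / 2) with hS'
  have hdisj : ∀ t, Disjoint (S t) (S' t) := by
    intro t
    rw [Finset.disjoint_left]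
    intro a ha ha'
    have h1 := (mem_highSet.1 ha).2
    have h2 := (mem_highSet.1 ha').2
    have h3 : ω ^ t * ((M - m) / 2) ≤ (M - m) / 2 :=
      mul_le_of_le_one_left hδ (pow_le_one₀ hω hω1)
    have h4 : 0 ≤ (t : ℝ) * u k := mul_nonneg t.cast_nonneg (hu0 k)
    simp only [Pi.neg_apply] at h2
    linarith
  -- Robustness applies only while both sets are nonempty, and then their total size drops by at
  -- least one per step.
  have key : ∀ t, S t = ∅ ∨ S' t = ∅ ∨ (S t).card + (S' t).card + t ≤ Fintype.card V := by
    intro t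
    induction t with
    | zero =>
      right; right
      rw [add_zero, ← Finset.card_union_of_disjoint (hdisj 0)]
      exact Finset.card_le_univ _
    | succ t ih =>
      have hsub := hx.level_succ_subset hu hω hδ hM t
      have hsub' := hx'.level_succ_subset hu hω hδ hm' t
      rcases (S t).eq_empty_or_nonempty with he | hne
      · exact Or.inl (Finset.subset_empty.1 (he ▸ hsub))
      rcases (S' t).eq_empty_or_nonempty with he' | hne'
      · exact Or.inr (Or.inl (Finset.subset_empty.1 (he' ▸ hsub')))
      have hle := (ih.resolve_left hne.ne_empty).resolve_left hne'.ne_empty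
      right; right
      have hc := Finset.card_le_card hsub
      have hc' := Finset.card_le_card hsub'
      rcases hG (S t) (S' t) hne hne' (hdisj t) with hr | hr
      · have := hx.card_level_succ_lt hu hω hδ hM hr
        simp only [hS, hS'] at *
        omega
      · have := hx'.card_level_succ_lt hu hω hδ hm' hr
        simp only [hS, hS'] at *
        omega
  have hN : S (Fintype.card V) = ∅ ∨ S' (Fintype.card V) = ∅ := by
    rcases key (Fintype.card V) with h | h | h
    · exact Or.inl h
    · exact Or.inr h
    · exact Or.inl (Finset.card_eq_zero.1 (by omega))
  have h1 := hx.le_add hu hM (Fintype.card V) i hi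
  have h2 := hx'.le_add hu hm' (Fintype.card V) j hj
  simp only [Pi.neg_apply] at h2
  -- The side whose set is empty gains ω ^ |V| (M - m) / 2; the other side has only the drift bound.
  rcases hN with h | h
  · have := le_of_level_eq_empty h hi
    linarith
  · have := le_of_level_eq_empty h hj
    simp only [Pi.neg_apply] at this
    linarith

/-- Consensus of scalar values over a robust graph under vanishing perturbations. -/
theorem tendsto_sub (hx : ContractsAbove G A r ω u x) (hx' : ContractsAbove G A r ω u (-x))
    (hG : IsRobust G r) (hu : Antitone u) (hu0 : ∀ k, 0 ≤ u k) (hul : Tendsto u atTop (𝓝 0))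
    (hω : 0 < ω) (hω1 : ω ≤ 1) {i j : V} (hi : i ∉ A) (hj : j ∉ A) :
    Tendsto (fun k => x k i - x k j) atTop (𝓝 0) := by
  have hne : (Aᶜ).Nonempty := ⟨i, Finset.mem_compl.2 hi⟩
  have hle : ∀ k a, a ∉ A → x k a ≤ (Aᶜ).sup' hne (x k) := fun k a ha =>
    Finset.le_sup' (x k) (Finset.mem_compl.2 ha)
  have hge : ∀ k a, a ∉ A → (Aᶜ).inf' hne (x k) ≤ x k a := fun k a ha =>
    Finset.inf'_le (x k) (Finset.mem_compl.2 ha)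
  have hD : Tendsto (fun k => (Aᶜ).sup' hne (x k) - (Aᶜ).inf' hne (x k)) atTop (𝓝 0) := by
    have hpow : 0 < ω ^ Fintype.card V := pow_pos hω _
    have hpow1 : ω ^ Fintype.card V ≤ 1 := pow_le_one₀ hω.le hω1
    refine tendsto_zero_of_add_le_mul_add (Fintype.card_pos_iff.2 ⟨i⟩)
      (q := 1 - ω ^ Fintype.card V / 2) (c := fun k => 2 * Fintype.card V * u k)
      (by linarith) (by linarith)
      (fun k => sub_nonneg.2 ((hge k i hi).trans (hle k i hi))) ?_ (fun k => ?_)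
    · simpa using hul.const_mul (2 * (Fintype.card V : ℝ))
    · obtain ⟨a, ha, hae⟩ :=
        Finset.exists_mem_eq_sup' hne (x (k + Fintype.card V))
      obtain ⟨b, hb, hbe⟩ :=
        Finset.exists_mem_eq_inf' hne (x (k + Fintype.card V))
      rw [hae, hbe]
      exact hx.sub_le_of_isRobust hx' hG hu hu0 hω.le hω1
        ((hge k i hi).trans (hle k i hi)) (hle k) (hge k)
        (Finset.mem_compl.1 ha) (Finset.mem_compl.1 hb)
  refine squeeze_zero_norm (fun k => ?_) hD
  rw [Real.norm_eq_abs, abs_le]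
  have h1 := hle k i hi
  have h2 := hle k j hj
  have h3 := hge k i hi
  have h4 := hge k j hj
  constructor <;> linarith

end ContractsAbove

/-! ### From the filters to the contraction property -/

/-- One component of the state update: averaging over the nodes kept by `2d + 1` filters, one of
which removes the large values of the component, contracts the component from above. -/
theorem sum_mul_le_of_filters {d F : ℕ} (ℓ : Fin d) {i : V} {val w : V → ℝ}
    {D : Finset V} {P Q : Fin d → Finset V} {K : Finset V} {M b : ℝ}
    (hlocal : IsLocalSet G F A) (hi : i ∉ A)
    (hK : ∀ j, j ∈ K ↔ j ∈ insert i (inNbrs G i) ∧ j ∉ D ∧ ∀ m, j ∉ P m ∧ j ∉ Q m)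
    (hiK : i ∈ K) (hD : D.card ≤ F) (hP : ∀ m, (P m).card ≤ F) (hQ : ∀ m, (Q m).card ≤ F)
    (hPℓ : RemovesLargest F (insert i (inNbrs G i) \ D) val i (P ℓ))
    (hw : ∀ j ∈ K, 0 ≤ w j) (hwω : ∀ j ∈ K, ω ≤ w j) (hsum : ∑ j ∈ K, w j = 1)
    (hM : ∀ j, j ∉ A → val j ≤ M) (hbM : b ≤ M)
    (h : val i ≤ b ∨
      (2 * d + 1) * F + 1 ≤ (inNbrs G i \ highSet A val b).card) :
    ∑ j ∈ K, w j * val j ≤ M - ω * (M - b) := by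
  have hKM : ∀ j ∈ K, val j ≤ M := by
    intro j hj
    obtain ⟨hj1, hj2, hj3⟩ := (hK j).1 hj
    refine hPℓ.le_of_notMem (A := A) ?_ (fun a _ ha => hM a ha) (hM i hi)
      (Finset.mem_sdiff.2 ⟨hj1, hj2⟩) (hj3 ℓ).1
    refine (Finset.card_le_card fun a ha => ?_).trans (hlocal i hi)
    obtain ⟨ha1, haA⟩ := Finset.mem_inter.1 ha
    refine Finset.mem_inter.2 ⟨?_, haA⟩
    refine (Finset.mem_insert.1 (Finset.mem_sdiff.1 ha1).1).resolve_left ?_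
    rintro rfl
    exact hi haA
  obtain ⟨j, hjK, hjb⟩ : ∃ j ∈ K, val j ≤ b := by
    by_cases hib : val i ≤ b
    · exact ⟨i, hiK, hib⟩
    have hN := h.resolve_left hib
    have hmem : ∀ j ∈ (inNbrs G i \ highSet A val b) \ A, j ∈ inNbrs G i ∧ val j ≤ b := by
      intro j hj
      obtain ⟨hj1, hjA⟩ := Finset.mem_sdiff.1 hj
      obtain ⟨hj1, hj2⟩ := Finset.mem_sdiff.1 hj1
      refine ⟨hj1, ?_⟩
      by_contra! hcon
      exact hj2 (mem_highSet.2 ⟨hjA, hcon⟩)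
    -- `highSet` contains no Byzantine nodes, so up to `F` of them are counted outside it and must
    -- be subtracted.
    have hcard : 2 * d * F < ((inNbrs G i \ highSet A val b) \ A).card := by
      have h1 := Finset.card_sdiff_add_card_inter (inNbrs G i \ highSet A val b) A
      have h2 : ((inNbrs G i \ highSet A val b) ∩ A).card ≤ F :=
        (Finset.card_le_card (Finset.inter_subset_inter_right Finset.sdiff_subset)).trans
          (hlocal i hi)
      nlinarith
    obtain ⟨j, hj, hjD, hjPQ⟩ := exists_mem_notMem_discarded ℓ hcard hD hP hQ <| by
      intro j hj hjP
      exact hib ((hPℓ.lt_of_mem hjP).le.trans (hmem j hj).2)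
    exact ⟨j, (hK j).2 ⟨Finset.mem_insert_of_mem (hmem j hj).1, hjD, hjPQ⟩, (hmem j hj).2⟩
  exact sum_mul_le_of_weight_le hw hsum hKM hjK hjb (hwω j hjK) hbM

namespace Run

variable {d F : ℕ} {ρ : Run V d} {f : V → EuclideanSpace ℝ (Fin d) → ℝ} {η : ℕ → ℝ}

theorem mem_mmKept {k : ℕ} {i j : V} :
    j ∈ ρ.mmKept G k i ↔ j ∈ insert i (inNbrs G i) ∧ j ∉ ρ.distRem k i ∧
      ∀ m, j ∉ ρ.xHighRem k i m ∧ j ∉ ρ.xLowRem k i m := by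
  simp only [mmKept, distKept, Finset.mem_sdiff, Finset.mem_biUnion, Finset.mem_univ, true_and,
    Finset.mem_union, not_exists, not_or, and_assoc]

theorem Follows.self_mem_mmKept (h : ρ.Follows G A F f η) (k : ℕ) {i : V} (hi : i ∉ A) :
    i ∈ ρ.mmKept G k i :=
  mem_mmKept.2 ⟨Finset.mem_insert_self _ _,
    fun hm => lt_irrefl _ ((h.dist_filt k i hi).lt_of_mem hm),
    fun m => ⟨fun hm => lt_irrefl _ ((h.x_high_filt k i hi m).lt_of_mem hm),
      fun hm => lt_irrefl _ (RemovesLargest.lt_of_mem (h.x_low_filt k i hi m) hm)⟩⟩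

theorem Follows.x_succ_apply (h : ρ.Follows G A F f η) (k : ℕ) {i : V} (hi : i ∉ A)
    (ℓ : Fin d) :
    ρ.x (k + 1) i ℓ =
      ∑ j ∈ ρ.mmKept G k i, ρ.wx k i j * ρ.recvX A k i j ℓ - η k * ρ.g k i ℓ := by
  rw [h.x_succ k i hi, h.z_eq k i hi]
  simp

theorem Follows.abs_mul_g_le (h : ρ.Follows G A F f η) (hη : ∀ k, 0 ≤ η k) {L : ℝ}
    (hL : ∀ (x : EuclideanSpace ℝ (Fin d)) (i : V), ∀ g ∈ subdifferential (f i) x, ‖g‖ ≤ L)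
    (k : ℕ) {i : V} (hi : i ∉ A) (ℓ : Fin d) : |η k * ρ.g k i ℓ| ≤ η k * L := by
  rw [abs_mul, abs_of_nonneg (hη k)]
  refine mul_le_mul_of_nonneg_left ?_ (hη k)
  exact (PiLp.norm_apply_le (ρ.g k i) ℓ).trans (hL _ i _ (h.g_mem k i hi))

omit [Fintype V] in
theorem recvX_of_notMem {k : ℕ} {i j : V} (hj : j ∉ A) : ρ.recvX A k i j = ρ.x k j :=
  if_neg hj

theorem highSet_recvX_apply (k : ℕ) (i : V) (ℓ : Fin d) (b : ℝ) :
    highSet A (fun j => ρ.recvX A k i j ℓ) b = highSet A (fun j => ρ.x k j ℓ) b := by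
  ext j
  simp only [mem_highSet]
  exact and_congr_right fun hj => by rw [recvX_of_notMem hj]

theorem highSet_neg_recvX_apply (k : ℕ) (i : V) (ℓ : Fin d) (b : ℝ) :
    highSet A (fun j => -ρ.recvX A k i j ℓ) b = highSet A (fun j => -ρ.x k j ℓ) b := by
  ext j
  simp only [mem_highSet]
  exact and_congr_right fun hj => by rw [recvX_of_notMem hj]

theorem Follows.contractsAbove_apply {L : ℝ} (h : ρ.Follows G A F f η) (hlocal : IsLocalSet G F A)
    (hη : ∀ k, 0 ≤ η k)
    (hL : ∀ (x : EuclideanSpace ℝ (Fin d)) (i : V), ∀ g ∈ subdifferential (f i) x, ‖g‖ ≤ L)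
    (hω : ∀ k i, i ∉ A → ∀ j ∈ ρ.mmKept G k i, ω ≤ ρ.wx k i j) (ℓ : Fin d) :
    ContractsAbove G A ((2 * d + 1) * F + 1) ω (fun k => η k * L) (fun k i => ρ.x k i ℓ) := by
  intro k i hi M b hM hbM hib
  have hsum := sum_mul_le_of_filters ℓ (val := fun j => ρ.recvX A k i j ℓ) (M := M) (b := b)
    hlocal hi (fun j => mem_mmKept) (h.self_mem_mmKept k hi) (h.dist_filt k i hi).card_le
    (fun m => (h.x_high_filt k i hi m).card_le)
    (fun m => RemovesLargest.card_le (h.x_low_filt k i hi m)) (h.x_high_filt k i hi ℓ)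
    (fun j hj => (h.wx_pos k i hi j hj).le) (hω k i hi) (h.wx_sum k i hi)
    (fun j hj => by simpa only [recvX_of_notMem hj] using hM j hj) hbM
    (by simpa only [highSet_recvX_apply, recvX_of_notMem hi] using hib)
  have hg := neg_le_of_abs_le (h.abs_mul_g_le hη hL k hi ℓ)
  simp only [h.x_succ_apply k hi ℓ]
  linarith

/-- Negation exchanges the two min-max filters: `RemovesSmallest` is by definition `RemovesLargest`
for the negated values, so the low filter now plays the part of `P`. -/
theorem Follows.contractsAbove_neg_apply {L : ℝ} (h : ρ.Follows G A F f η) (hlocal : IsLocalSet G F A)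
    (hη : ∀ k, 0 ≤ η k)
    (hL : ∀ (x : EuclideanSpace ℝ (Fin d)) (i : V), ∀ g ∈ subdifferential (f i) x, ‖g‖ ≤ L)
    (hω : ∀ k i, i ∉ A → ∀ j ∈ ρ.mmKept G k i, ω ≤ ρ.wx k i j) (ℓ : Fin d) :
    ContractsAbove G A ((2 * d + 1) * F + 1) ω (fun k => η k * L) (-fun k i => ρ.x k i ℓ) := by
  intro k i hi M b hM hbM hib
  change ∀ j, j ∉ A → -ρ.x k j ℓ ≤ M at hM
  change -ρ.x k i ℓ ≤ b ∨ _ ≤ (inNbrs G i \ highSet A (fun j => -ρ.x k j ℓ) b).card at hib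
  have hsum := sum_mul_le_of_filters ℓ (val := fun j => -ρ.recvX A k i j ℓ) (M := M) (b := b)
    hlocal hi (fun j => by rw [mem_mmKept]; simp only [and_comm]) (h.self_mem_mmKept k hi)
    (h.dist_filt k i hi).card_le (fun m => RemovesLargest.card_le (h.x_low_filt k i hi m))
    (fun m => (h.x_high_filt k i hi m).card_le) (h.x_low_filt k i hi ℓ)
    (fun j hj => (h.wx_pos k i hi j hj).le) (hω k i hi) (h.wx_sum k i hi)
    (fun j hj => by simpa only [recvX_of_notMem hj] using hM j hj) hbM
    (by simpa only [highSet_neg_recvX_apply, recvX_of_notMem hi] using hib)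
  have hg := le_of_abs_le (h.abs_mul_g_le hη hL k hi ℓ)
  simp only [Pi.neg_apply, h.x_succ_apply k hi ℓ]
  simp only [mul_neg, Finset.sum_neg_distrib] at hsum
  linarith

end Run

end Consensus

end ResilientOpt

theorem theorem1 {V : Type*} [Fintype V] [DecidableEq V] {d : ℕ}
    (G : Digraph V) (A : Finset V) (F : ℕ) (hF : 0 < F)
    (f : V → EuclideanSpace ℝ (Fin d) → ℝ)
    (hconvex : ∀ i, ConvexOn ℝ Set.univ (f i))
    (hgrad : ∃ L : ℝ, 0 < L ∧ ∀ (x : EuclideanSpace ℝ (Fin d)) (i : V),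
      ∀ g ∈ ResilientOpt.subdifferential (f i) x, ‖g‖ ≤ L)
    (η : ℕ → ℝ)
    (hstep : ∃ c₁ c₂ : ℝ, 0 < c₁ ∧ 0 < c₂ ∧ ∀ k : ℕ, η k = c₁ / ((k : ℝ) + c₂))
    (hlocal : ResilientOpt.IsLocalSet G F A)
    (hrobust : ResilientOpt.IsRobust G ((2 * d + 1) * F + 1))
    (ρ : ResilientOpt.Run V d)
    (hfollows : ρ.Follows G A F f η)
    (hweights : ρ.WeightAssumption G A) :
    ∀ i, i ∉ A → ∀ j, j ∉ A →
      Tendsto (fun k => ‖ρ.x k i - ρ.x k j‖) atTop (𝓝 0) := by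
  obtain ⟨L, hL0, hL⟩ := hgrad
  obtain ⟨c₁, c₂, hc₁, hc₂, hη⟩ := hstep
  obtain ⟨hwx, -, ω, hω0, hω, -⟩ := hweights
  intro i hi j hj
  have hpos : ∀ k : ℕ, 0 < (k : ℝ) + c₂ := fun k => by positivity
  have hη0 : ∀ k, 0 ≤ η k := fun k => by rw [hη]; exact (div_pos hc₁ (hpos k)).le
  have hanti : Antitone fun k => η k * L := by
    intro a b hab
    have hab' : (a : ℝ) ≤ b := Nat.cast_le.2 hab
    simp only [hη]
    exact mul_le_mul_of_nonneg_right
      (div_le_div_of_nonneg_left hc₁.le (hpos a) (by linarith)) hL0.le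
  have hlim : Tendsto (fun k => η k * L) atTop (𝓝 0) := by
    have h : Tendsto (fun k : ℕ => c₁ / ((k : ℝ) + c₂)) atTop (𝓝 0) :=
      (tendsto_natCast_atTop_atTop.atTop_add tendsto_const_nhds).const_div_atTop c₁
    simpa only [hη, zero_mul] using h.mul_const L
  -- Truncation at 1 provides the bound ω ≤ 1 required for the powers ω ^ t.
  have hω' : ∀ k i, i ∉ A → ∀ j ∈ ρ.mmKept G k i, min ω 1 ≤ ρ.wx k i j := fun k i hi j hj =>
    (min_le_left _ _).trans (hω k i hi j ((hwx k i hi j).2 hj).ne')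
  have hcoord : ∀ ℓ, Tendsto (fun k => ρ.x k i ℓ - ρ.x k j ℓ) atTop (𝓝 0) := fun ℓ =>
    (hfollows.contractsAbove_apply hlocal hη0 hL hω' ℓ).tendsto_sub
      (hfollows.contractsAbove_neg_apply hlocal hη0 hL hω' ℓ) hrobust hanti
      (fun k => mul_nonneg (hη0 k) hL0.le) hlim (lt_min hω0 one_pos) (min_le_right _ _) hi hj
  have hsq : Tendsto (fun k => √(∑ ℓ, ‖(ρ.x k i - ρ.x k j) ℓ‖ ^ 2)) atTop (𝓝 √0) := by
    refine Tendsto.sqrt ?_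
    simpa using tendsto_finsetSum Finset.univ fun ℓ _ => (hcoord ℓ).norm.pow 2
  simpa only [EuclideanSpace.norm_eq, Real.sqrt_zero] using hsq
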